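/- Let $\mathcal H$ be a finite-dimensional complex Hilbert space, and let $\rho,\sigma$ be quantum states on $\mathcal H$, i.e. positive semidefinite operators of trace one. Let $\varepsilon\ge 0$ and suppose that the pair $(\rho,\sigma)$ is (pure) $\varepsilon$-differentially private: for every operator $\Lambda$ with $0\preceq\Lambda\preceq I$, $$\mathrm{Tr}[\Lambda\rho]\le e^{\varepsilon}\,\mathrm{Tr}[\Lambda\sigma]\quad\text{and}\quad \mathrm{Tr}[\Lambda\sigma]\le e^{\varepsilon}\,\mathrm{Tr}[\Lambda\rho].$$ Then (i) $D(\rho\|\sigma)\le\varepsilon\tanh\left(\frac{\varepsilon}{2}\right)$, and (ii) $\|\rho-\sigma\|_1\le 2\tanh\left(\frac{\varepsilon}{2}\right)$. Here $D(\rho\|\sigma)=\mathrm{Tr}[\rho(\log\rho-\log\sigma)]$ (natural logarithm, with logarithms taken on the supports) if the support of $\rho$ is contained in that of $\sigma$, $D(\rho\|\sigma)=+\infty$ otherwise, and $\|A\|_1=\mathrm{Tr}\sqrt{A^\dagger A}$ is the trace norm. -/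

import Mathlib

namespace QuantumDP

open Matrix
open scoped ComplexOrder

variable {n : Type*} [Fintype n] [DecidableEq n]

/-- The set of quantum states (density matrices) on the Hilbert space with orthonormal basis
indexed by the finite type `n`: positive semidefinite complex matrices of trace one. -/
def states (n : Type*) [Fintype n] : Set (Matrix n n ℂ) :=
  {ρ | ρ.PosSemidef ∧ ρ.trace = 1}

/-- The set of `(ε, δ)`-differentially private pairs of quantum states:
for every effect `0 ≤ Λ ≤ 1`, `Tr[Λ ρ] ≤ e ^ ε * Tr[Λ σ] + δ` and
`Tr[Λ σ] ≤ e ^ ε * Tr[Λ ρ] + δ`. All these traces are real. -/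
def dpPairs (n : Type*) [Fintype n] [DecidableEq n] (ε δ : ℝ) :
    Set (Matrix n n ℂ × Matrix n n ℂ) :=
  {p | p.1 ∈ states n ∧ p.2 ∈ states n ∧
    ∀ Λ : Matrix n n ℂ, Λ.PosSemidef → (1 - Λ).PosSemidef →
      (Λ * p.1).trace.re ≤ Real.exp ε * (Λ * p.2).trace.re + δ ∧
      (Λ * p.2).trace.re ≤ Real.exp ε * (Λ * p.1).trace.re + δ}

/-- The support of a state: the span of its eigenvectors with positive eigenvalue. -/
def supp (ρ : Matrix n n ℂ) : Submodule ℂ (n → ℂ) :=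
  Submodule.span ℂ {v | ∃ μ : ℝ, 0 < μ ∧ ρ *ᵥ v = (μ : ℂ) • v}

/-- The natural logarithm of a Hermitian matrix by functional calculus. As `Real.log 0 = 0`, the
logarithm of a positive semidefinite matrix is taken on its support and is zero on its kernel. -/
noncomputable def log (A : Matrix n n ℂ) : Matrix n n ℂ := cfc Real.log A

open Classical in
/-- The quantum relative entropy `D(ρ‖σ)`, equal to `Tr[ρ (log ρ - log σ)]` (a real number) if the
support of `ρ` is contained in that of `σ`, and to `+∞` otherwise. -/
noncomputable def relEntropy (ρ σ : Matrix n n ℂ) : EReal :=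
  if supp ρ ≤ supp σ then (((ρ * (log ρ - log σ)).trace.re : ℝ) : EReal) else ⊤

/-- The trace norm (Schatten 1-norm) `‖A‖₁ = Tr √(Aᴴ A)`. -/
noncomputable def traceNorm (A : Matrix n n ℂ) : ℝ := (cfc Real.sqrt (Aᴴ * A)).trace.re

end QuantumDP

namespace QuantumDP

open Matrix Filter Topology
open scoped ComplexOrder

/-! Testing on spectral projectors turns privacy into the operator bounds `ρ ≤ e^ε σ` and `σ ≤ e^ε
ρ` (`dp_posSemidef`). By `exists_congruence`, `σ = R Rᴴ` and `ρ = R diag(x) Rᴴ` with every `x k` in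
`[e^(-ε), e^ε]`. The squared column norms `q` of `R` form a probability vector under which `x` has
mean one, and the chord of the convex function `x log x` bounds its `q`-average by `ε tanh(ε/2)`
(`sum_mul_log_le_tanh`).

This average is the Belavkin–Staszewski entropy, so it remains to show that it dominates `D(ρ‖σ)`.
In the eigenbases, `D` is the average of `y log y` for ratios `y` of eigenvalues of `ρ` and `σ`.
Integrating over resolvents reduces the comparison to that of `1 / (· + t)`
(`sum_mul_log_le_of_resolvent`). There the quantum side is the value of a concave quadratic
functional at a well-chosen matrix, which `variational_le` bounds by the classical side.

The trace-norm bound is independent of this: apply privacy to the projector onto the positive part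
of `ρ - σ` and to its complement. -/

/-! ### Scalar inequalities for averages of `x log x`. -/

lemma hasDerivAt_logGap {x T : ℝ} (hx : 0 ≤ x) (hT : 0 < T) :
    HasDerivAt (fun T => x * Real.log x - x * Real.log (x + T)) (T * (1 / (x + T)) - 1) T := by
  have hp : 0 < x + T := by linarith
  have := ((((hasDerivAt_id T).const_add x).log hp.ne').const_mul x).const_sub (x * Real.log x)
  refine this.congr_deriv ?_
  simp only [id]
  field_simp
  ring

lemma continuousOn_logGap {x : ℝ} (hx : 0 ≤ x) :
    ContinuousOn (fun T => x * Real.log x - x * Real.log (x + T)) (Set.Ici 0) := by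
  rcases hx.eq_or_lt with rfl | hx
  · simpa using continuousOn_const
  · refine continuousOn_const.sub (continuousOn_const.mul (ContinuousOn.log (by fun_prop) ?_))
    intro T hT
    have : (0 : ℝ) ≤ T := hT
    positivity

lemma tendsto_log_add_sub_log (x : ℝ) :
    Tendsto (fun T => x * (Real.log (x + T) - Real.log T)) atTop (𝓝 0) := by
  have h1 : Tendsto (fun T : ℝ => Real.log (x / T + 1)) atTop (𝓝 0) := by
    have h : Tendsto (fun T : ℝ => x / T + 1) atTop (𝓝 (0 + 1)) :=
      (tendsto_const_nhds.div_atTop tendsto_id).add_const 1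
    simpa using h.log (by norm_num)
  have h2 := h1.const_mul x
  rw [mul_zero] at h2
  refine h2.congr' ?_
  filter_upwards [eventually_gt_atTop 0, eventually_gt_atTop (-x)] with T hT hT'
  rw [← Real.log_div (by linarith) hT.ne', add_div, div_self hT.ne']

/-- If all the resolvent averages of one finite distribution on `[0, ∞)` dominate those of another
one with the same mass and mean, then so do the averages of `x * log x`. -/
theorem sum_mul_log_le_of_resolvent {ι κ : Type*} [Fintype ι] [Fintype κ]
    (p y : ι → ℝ) (q x : κ → ℝ) (hy : ∀ i, 0 ≤ y i) (hx : ∀ k, 0 ≤ x k)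
    (hmass : ∑ i, p i = ∑ k, q k) (hmean : ∑ i, p i * y i = ∑ k, q k * x k)
    (hres : ∀ t, 0 < t → ∑ i, p i * (1 / (y i + t)) ≤ ∑ k, q k * (1 / (x k + t))) :
    ∑ i, p i * (y i * Real.log (y i)) ≤ ∑ k, q k * (x k * Real.log (x k)) := by
  -- `g x T` is minus the integral of `x / (x + s)` over `[0, T]`. Its `T`-derivative is affine in
  -- the resolvent, so by equality of masses `G' T` is `T` times the resolvent gap.
  set g : ℝ → ℝ → ℝ := fun x T => x * Real.log x - x * Real.log (x + T)
  set G : ℝ → ℝ := fun T => ∑ k, q k * g (x k) T - ∑ i, p i * g (y i) T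
  have hder : ∀ T, 0 < T → HasDerivAt G (∑ k, q k * (T * (1 / (x k + T)) - 1)
      - ∑ i, p i * (T * (1 / (y i + T)) - 1)) T := fun T hT =>
    (HasDerivAt.fun_sum fun k _ => (hasDerivAt_logGap (hx k) hT).const_mul _).sub
      (HasDerivAt.fun_sum fun i _ => (hasDerivAt_logGap (hy i) hT).const_mul _)
  have hcont : ContinuousOn G (Set.Ici 0) :=
    (continuousOn_finsetSum _ fun k _ => continuousOn_const.mul (continuousOn_logGap (hx k))).sub
      (continuousOn_finsetSum _ fun i _ => continuousOn_const.mul (continuousOn_logGap (hy i)))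
  have hmono : MonotoneOn G (Set.Ici 0) := by
    refine monotoneOn_of_deriv_nonneg (convex_Ici 0) hcont ?_ ?_
    · intro T hT
      rw [interior_Ici] at hT
      exact (hder T hT).differentiableAt.differentiableWithinAt
    · intro T hT
      rw [interior_Ici] at hT
      rw [(hder T hT).deriv]
      have h1 : ∀ {α : Type _} [Fintype α] (q x : α → ℝ), ∑ k, q k * (T * (1 / (x k + T)) - 1)
          = T * ∑ k, q k * (1 / (x k + T)) - ∑ k, q k := by
        intro α _ q x
        rw [Finset.mul_sum, ← Finset.sum_sub_distrib]
        exact Finset.sum_congr rfl fun _ _ => by ring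
      have h2 : ∑ i, p i * (T * (1 / (y i + T)) - 1)
          = T * ∑ i, p i * (1 / (y i + T)) - ∑ i, p i := by
        rw [Finset.mul_sum, ← Finset.sum_sub_distrib]
        exact Finset.sum_congr rfl fun _ _ => by ring
      rw [h1, h2]
      have := mul_le_mul_of_nonneg_left (hres T hT) (le_of_lt hT)
      linarith
  have hG0 : G 0 = 0 := by simp [G, g]
  -- Each `x log (x + T)` diverges like `x log T`; equality of means cancels these terms.
  have hlim : Tendsto G atTop (𝓝 (∑ k, q k * (x k * Real.log (x k))
      - ∑ i, p i * (y i * Real.log (y i)))) := by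
    have h1 : Tendsto (fun T => (∑ k, q k * (x k * Real.log (x k))
        - ∑ i, p i * (y i * Real.log (y i)))
        - (∑ k, q k * (x k * (Real.log (x k + T) - Real.log T))
        - ∑ i, p i * (y i * (Real.log (y i + T) - Real.log T)))) atTop
        (𝓝 ((∑ k, q k * (x k * Real.log (x k)) - ∑ i, p i * (y i * Real.log (y i)))
          - (∑ k, q k * 0 - ∑ i, p i * 0))) :=
      ((tendsto_finsetSum _ fun k _ => (tendsto_log_add_sub_log (x k)).const_mul _).sub
        (tendsto_finsetSum _ fun i _ => (tendsto_log_add_sub_log (y i)).const_mul _)).const_sub _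
    simp only [mul_zero, Finset.sum_const_zero, sub_zero] at h1
    refine h1.congr fun T => ?_
    have h2 := congrArg (fun s => Real.log T * s) hmean
    simp only [Finset.mul_sum] at h2
    have e1 : ∑ k, q k * (x k * (Real.log (x k + T) - Real.log T))
        = ∑ k, q k * (x k * Real.log (x k + T)) - ∑ k, Real.log T * (q k * x k) := by
      rw [← Finset.sum_sub_distrib]
      exact Finset.sum_congr rfl fun _ _ => by ring
    have e2 : ∑ i, p i * (y i * (Real.log (y i + T) - Real.log T))
        = ∑ i, p i * (y i * Real.log (y i + T)) - ∑ i, Real.log T * (p i * y i) := by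
      rw [← Finset.sum_sub_distrib]
      exact Finset.sum_congr rfl fun _ _ => by ring
    simp only [G, g, mul_sub, Finset.sum_sub_distrib] at e1 e2 ⊢
    linarith
  have : 0 ≤ ∑ k, q k * (x k * Real.log (x k)) - ∑ i, p i * (y i * Real.log (y i)) :=
    ge_of_tendsto hlim ((eventually_ge_atTop 0).mono fun T hT =>
      hG0 ▸ hmono Set.self_mem_Ici hT hT)
  linarith

/-- The chord bound for `x * log x` on `[exp (-ε), exp ε]`, averaged over a distribution of
mean one. -/
theorem sum_mul_log_le_tanh {κ : Type*} [Fintype κ] {ε : ℝ} (hε : 0 ≤ ε) (q x : κ → ℝ)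
    (hq : ∀ k, 0 ≤ q k) (hmass : ∑ k, q k = 1) (hmean : ∑ k, q k * x k = 1)
    (hl : ∀ k, (Real.exp ε)⁻¹ ≤ x k) (hu : ∀ k, x k ≤ Real.exp ε) :
    ∑ k, q k * (x k * Real.log (x k)) ≤
      ε * ((Real.exp ε - 1) / (Real.exp ε + 1)) := by
  rcases hε.eq_or_lt with rfl | hε
  · have : ∀ k, x k = 1 := fun k => le_antisymm (by simpa using hu k) (by simpa using hl k)
    simp [this]
  set E := Real.exp ε
  have hE : 1 < E := Real.one_lt_exp_iff.2 hε
  have hE0 : 0 < E := by linarith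
  have hE2 : 0 < E ^ 2 - 1 := by nlinarith
  -- The line through the graph at `E⁻¹` and `E`. At the mean, one, its value is `ε (E - 1)² / (E² -
  -- 1)`.
  have hchord : ∀ k, x k * Real.log (x k) ≤
      ε * (E ^ 2 + 1) / (E ^ 2 - 1) * x k - 2 * E * ε / (E ^ 2 - 1) := by
    intro k
    have ha : 0 ≤ (E - x k) * E / (E ^ 2 - 1) :=
      div_nonneg (mul_nonneg (by linarith [hu k]) hE0.le) hE2.le
    have hb : 0 ≤ (x k * E - 1) / (E ^ 2 - 1) := by
      refine div_nonneg ?_ hE2.le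
      have := mul_le_mul_of_nonneg_right (hl k) hE0.le
      rw [inv_mul_cancel₀ hE0.ne'] at this
      linarith
    have hab : (E - x k) * E / (E ^ 2 - 1) + (x k * E - 1) / (E ^ 2 - 1) = 1 := by
      field_simp
      ring
    have h := Real.convexOn_mul_log.2 (x := E⁻¹) (y := E) (inv_nonneg.2 hE0.le) hE0.le ha hb hab
    have hx : ((E - x k) * E / (E ^ 2 - 1)) • E⁻¹ + ((x k * E - 1) / (E ^ 2 - 1)) • E = x k := by
      simp only [smul_eq_mul]
      field_simp
      ring
    rw [hx] at h
    simp only [Real.log_inv, show Real.log E = ε from Real.log_exp ε] at h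
    refine h.trans (le_of_eq ?_)
    simp only [smul_eq_mul]
    field_simp
    ring
  calc ∑ k, q k * (x k * Real.log (x k))
      ≤ ∑ k, q k * (ε * (E ^ 2 + 1) / (E ^ 2 - 1) * x k - 2 * E * ε / (E ^ 2 - 1)) :=
        Finset.sum_le_sum fun k _ => mul_le_mul_of_nonneg_left (hchord k) (hq k)
    _ = ε * (E ^ 2 + 1) / (E ^ 2 - 1) * ∑ k, q k * x k
        - 2 * E * ε / (E ^ 2 - 1) * ∑ k, q k := by
        rw [Finset.mul_sum, Finset.mul_sum, ← Finset.sum_sub_distrib]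
        exact Finset.sum_congr rfl fun _ _ => by ring
    _ = ε * ((E - 1) / (E + 1)) := by
        rw [hmass, hmean]
        have : E ^ 2 - 1 = (E - 1) * (E + 1) := by ring
        have h1 : E - 1 ≠ 0 := by linarith
        have h2 : E + 1 ≠ 0 := by linarith
        rw [this]
        field_simp
        ring

/-! ### Real diagonal matrices, diagonalization and effects. -/

lemma re_trace_mul {n : Type*} [Fintype n] (A B : Matrix n n ℂ) :
    (A * B).trace.re = ∑ i, ∑ j, (A i j * B j i).re := by
  simp only [trace, diag_apply, mul_apply, Complex.re_sum]

section

variable {n : Type*} [DecidableEq n]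

/-- The complex diagonal matrix with prescribed real diagonal entries. -/
def realDiag (d : n → ℝ) : Matrix n n ℂ := diagonal fun i => (d i : ℂ)

lemma realDiag_conjTranspose (d : n → ℝ) : (realDiag d)ᴴ = realDiag d := by
  simp only [realDiag, diagonal_conjTranspose]
  congr 1
  ext i
  simp

lemma realDiag_one : realDiag (fun _ : n => (1 : ℝ)) = 1 := by
  simp [realDiag]

lemma realDiag_sub (d e : n → ℝ) : realDiag d - realDiag e = realDiag fun i => d i - e i := by
  simp [realDiag]

lemma realDiag_add (d e : n → ℝ) : realDiag d + realDiag e = realDiag fun i => d i + e i := by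
  simp [realDiag]

lemma smul_realDiag (c : ℝ) (d : n → ℝ) : (c : ℂ) • realDiag d = realDiag fun i => c * d i := by
  ext i j
  by_cases h : i = j <;> simp [realDiag, h]

lemma realDiag_posSemidef {d : n → ℝ} : (realDiag d).PosSemidef ↔ ∀ i, 0 ≤ d i := by
  simp [realDiag, posSemidef_diagonal_iff]

end

variable {n : Type*} [Fintype n] [DecidableEq n]

lemma mul_realDiag_apply (M : Matrix n n ℂ) (d : n → ℝ) (i j : n) :
    (M * realDiag d) i j = M i j * (d j : ℂ) := by
  simp [realDiag, mul_diagonal]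

lemma realDiag_mul_apply (M : Matrix n n ℂ) (d : n → ℝ) (i j : n) :
    (realDiag d * M) i j = (d i : ℂ) * M i j := by
  simp [realDiag, diagonal_mul]

lemma realDiag_mul (d e : n → ℝ) : realDiag d * realDiag e = realDiag fun i => d i * e i := by
  simp [realDiag]

lemma trace_realDiag (d : n → ℝ) : (realDiag d).trace = ((∑ i, d i : ℝ) : ℂ) := by
  simp [realDiag, trace_diagonal]

/-- Simultaneous diagonalization of all functions of a Hermitian matrix. -/
lemma exists_diagonalization {A : Matrix n n ℂ} (hA : A.IsHermitian) :
    ∃ (V : Matrix n n ℂ) (μ : n → ℝ), Vᴴ * V = 1 ∧ V * Vᴴ = 1 ∧ A = V * realDiag μ * Vᴴ ∧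
      ∀ f : ℝ → ℝ, cfc f A = V * realDiag (fun i => f (μ i)) * Vᴴ := by
  refine ⟨hA.eigenvectorUnitary, hA.eigenvalues, ?_, ?_, ?_, fun f => ?_⟩
  · exact Unitary.coe_star_mul_self hA.eigenvectorUnitary
  · exact Unitary.coe_mul_star_self hA.eigenvectorUnitary
  · exact hA.spectral_theorem
  · rw [hA.cfc_eq]
    rfl

lemma trace_conj_unitary {V : Matrix n n ℂ} (hV : Vᴴ * V = 1) (X : Matrix n n ℂ) :
    (V * X * Vᴴ).trace = X.trace := by
  rw [trace_mul_comm, ← Matrix.mul_assoc, hV, Matrix.one_mul]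

lemma conj_unitary_mul {V : Matrix n n ℂ} (hV : Vᴴ * V = 1) (X Y : Matrix n n ℂ) :
    (V * X * Vᴴ) * (V * Y * Vᴴ) = V * (X * Y) * Vᴴ := by
  calc _ = V * X * (Vᴴ * V) * Y * Vᴴ := by simp only [Matrix.mul_assoc]
    _ = _ := by rw [hV]; simp only [Matrix.mul_assoc, Matrix.one_mul]

/-- The spectral projector `V * realDiag d * Vᴴ` with `0 ≤ d ≤ 1` is an effect. -/
lemma effect_of_realDiag {V : Matrix n n ℂ} (hV : V * Vᴴ = 1) {d : n → ℝ}
    (h0 : ∀ i, 0 ≤ d i) (h1 : ∀ i, d i ≤ 1) :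
    (V * realDiag d * Vᴴ).PosSemidef ∧ (1 - V * realDiag d * Vᴴ).PosSemidef := by
  refine ⟨(realDiag_posSemidef.2 h0).mul_mul_conjTranspose_same V, ?_⟩
  have h : 1 - V * realDiag d * Vᴴ = V * realDiag (fun i => 1 - d i) * Vᴴ := by
    rw [← realDiag_sub, realDiag_one, Matrix.mul_sub, Matrix.sub_mul, Matrix.mul_one, hV]
  rw [h]
  exact (realDiag_posSemidef.2 fun i => sub_nonneg.2 (h1 i)).mul_mul_conjTranspose_same V

/-- A Hermitian matrix with nonnegative expectation on all effects is positive semidefinite. -/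
lemma posSemidef_of_effects {A : Matrix n n ℂ} (hA : A.IsHermitian)
    (h : ∀ Λ : Matrix n n ℂ, Λ.PosSemidef → (1 - Λ).PosSemidef → 0 ≤ (Λ * A).trace.re) :
    A.PosSemidef := by
  obtain ⟨V, μ, hV, hV', rfl, -⟩ := exists_diagonalization hA
  refine (realDiag_posSemidef.2 fun j => ?_).mul_mul_conjTranspose_same V
  -- The projector onto the `j`-th eigenvector has expectation `μ j`.
  obtain ⟨h1, h2⟩ := effect_of_realDiag hV' (d := fun i => if i = j then 1 else 0)
    (fun i => by split_ifs <;> simp) (fun i => by split_ifs <;> simp)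
  have := h _ h1 h2
  rw [conj_unitary_mul hV, trace_conj_unitary hV, realDiag_mul, trace_realDiag] at this
  simpa using this

lemma dp_posSemidef {ε : ℝ} {ρ σ : Matrix n n ℂ} (h : (ρ, σ) ∈ dpPairs n ε 0) :
    (((Real.exp ε : ℝ) : ℂ) • σ - ρ).PosSemidef ∧ (((Real.exp ε : ℝ) : ℂ) • ρ - σ).PosSemidef := by
  obtain ⟨hρ, hσ, h⟩ := h
  have key : ∀ ρ σ : Matrix n n ℂ, ρ.PosSemidef → σ.PosSemidef →
      (∀ Λ : Matrix n n ℂ, Λ.PosSemidef → (1 - Λ).PosSemidef →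
        (Λ * ρ).trace.re ≤ Real.exp ε * (Λ * σ).trace.re + 0) →
      (((Real.exp ε : ℝ) : ℂ) • σ - ρ).PosSemidef := by
    intro ρ σ hρ hσ h
    refine posSemidef_of_effects (IsHermitian.sub ?_ hρ.1) fun Λ h0 h1 => ?_
    · have := hσ.1
      rw [IsHermitian] at this ⊢
      rw [conjTranspose_smul, this, Complex.star_def, Complex.conj_ofReal]
    · have := h Λ h0 h1
      rw [Matrix.mul_sub, Matrix.mul_smul, trace_sub, trace_smul, smul_eq_mul, Complex.sub_re,
        Complex.re_ofReal_mul]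
      linarith
  exact ⟨key ρ σ hρ.1 hσ.1 fun Λ h0 h1 => (h Λ h0 h1).1,
    key σ ρ hσ.1 hρ.1 fun Λ h0 h1 => (h Λ h0 h1).2⟩

lemma tanh_half_eq (ε : ℝ) : Real.tanh (ε / 2) = (Real.exp ε - 1) / (Real.exp ε + 1) := by
  have h : Real.exp ε = Real.exp (ε / 2) * Real.exp (ε / 2) := by
    rw [← Real.exp_add]; ring_nf
  have hp := Real.exp_pos (ε / 2)
  rw [Real.tanh_eq_sinh_div_cosh, Real.sinh_eq, Real.cosh_eq, Real.exp_neg, h]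
  field_simp

/-! ### The trace-norm bound. -/

/-- The trace-norm bound for differentially private pairs. -/
theorem traceNorm_sub_le {ε : ℝ} {ρ σ : Matrix n n ℂ} (h : (ρ, σ) ∈ dpPairs n ε 0) :
    traceNorm (ρ - σ) ≤ 2 * Real.tanh (ε / 2) := by
  obtain ⟨⟨hρ, hρ1⟩, ⟨hσ, hσ1⟩, h⟩ := h
  have hH : (ρ - σ).IsHermitian := hρ.1.sub hσ.1
  obtain ⟨V, μ, hV, hV', hA, hf⟩ := exists_diagonalization hH
  have hnorm : traceNorm (ρ - σ) = ∑ i, |μ i| := by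
    have h2 : (ρ - σ)ᴴ * (ρ - σ) = cfc (fun x : ℝ => x ^ 2) (ρ - σ) := by
      rw [hf, hH, hA, conj_unitary_mul hV, realDiag_mul]
      simp only [sq]
    have hfin : ∀ g : ℝ → ℝ, ContinuousOn g (spectrum ℝ (ρ - σ)) := fun g =>
      Matrix.finite_real_spectrum.continuousOn g
    rw [traceNorm, h2, ← cfc_comp' Real.sqrt (fun x : ℝ => x ^ 2) (ρ - σ)
      ((Matrix.finite_real_spectrum.image _).continuousOn _) (hfin _) hH.isSelfAdjoint, hf,
      trace_conj_unitary hV, trace_realDiag, Complex.ofReal_re]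
    simp [Real.sqrt_sq_eq_abs]
  have hsum : ∑ i, μ i = 0 := by
    have : (ρ - σ).trace = 0 := by rw [trace_sub, hρ1, hσ1, sub_self]
    rw [hA, trace_conj_unitary hV, trace_realDiag] at this
    exact_mod_cast this
  obtain ⟨h1, h2⟩ := effect_of_realDiag hV' (d := fun i => if 0 < μ i then 1 else 0)
    (fun i => by split_ifs <;> simp) (fun i => by split_ifs <;> simp)
  set Λ := V * realDiag (fun i => if 0 < μ i then (1 : ℝ) else 0) * Vᴴ with hΛ
  -- As the eigenvalues sum to zero, adding `μ i` is free and turns `|μ i|` into twice the positive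
  -- part.
  have hdiff : ∑ i, |μ i| = 2 * ((Λ * ρ).trace.re - (Λ * σ).trace.re) := by
    have h3 : ∑ i, |μ i| = ∑ i, (|μ i| + μ i) := by
      rw [Finset.sum_add_distrib, hsum, add_zero]
    rw [← Complex.sub_re, ← trace_sub, ← Matrix.mul_sub, hA, hΛ, conj_unitary_mul hV,
      trace_conj_unitary hV, realDiag_mul, trace_realDiag, Complex.ofReal_re, h3, Finset.mul_sum]
    refine Finset.sum_congr rfl fun i _ => ?_
    split_ifs with hi
    · rw [abs_of_pos hi]; ring
    · rw [abs_of_nonpos (not_lt.1 hi)]; ring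
  have ha := (h Λ h1 h2).1
  -- With `a = Tr Λρ` and `b = Tr Λσ`, adding `a ≤ E b` and `1 - b ≤ E (1 - a)` gives `(E + 1)(a -
  -- b) ≤ E - 1`.
  have hb := (h (1 - Λ) h2 (by rwa [sub_sub_cancel])).2
  simp only [Matrix.sub_mul, Matrix.one_mul, trace_sub, hρ1, hσ1, Complex.sub_re,
    Complex.one_re] at ha hb
  rw [hnorm, hdiff, tanh_half_eq]
  have hE := Real.exp_pos ε
  refine mul_le_mul_of_nonneg_left ?_ zero_le_two
  rw [le_div_iff₀ (by linarith)]
  nlinarith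

/-! ### Variational comparison of resolvents. -/

lemma re_trace_conjTranspose_mul_diag_mul (d : n → ℝ) (Y : Matrix n n ℂ) :
    (Yᴴ * realDiag d * Y).trace.re = ∑ i, ∑ j, d i * Complex.normSq (Y i j) := by
  rw [re_trace_mul, Finset.sum_comm]
  simp only [mul_realDiag_apply, conjTranspose_apply]
  refine Finset.sum_congr rfl fun j _ => Finset.sum_congr rfl fun i _ => ?_
  simp [Complex.normSq_apply]
  ring

lemma re_trace_mul_diag_mul_conjTranspose (d : n → ℝ) (Y : Matrix n n ℂ) :
    (Y * realDiag d * Yᴴ).trace.re = ∑ i, ∑ j, d j * Complex.normSq (Y i j) := by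
  simp only [re_trace_mul, mul_realDiag_apply, conjTranspose_apply]
  refine Finset.sum_congr rfl fun j _ => Finset.sum_congr rfl fun i _ => ?_
  simp [Complex.normSq_apply]
  ring

lemma two_mul_re_conj_mul_le {c : ℝ} (hc : 0 < c) (r m : ℂ) :
    2 * (star r * m).re ≤ Complex.normSq r / c + c * Complex.normSq m := by
  have h : Complex.normSq r / c + c * Complex.normSq m - 2 * (star r * m).re
      = ((r.re - c * m.re) ^ 2 + (r.im - c * m.im) ^ 2) / c := by
    simp [Complex.normSq_apply]
    field_simp
    ring
  have : 0 ≤ ((r.re - c * m.re) ^ 2 + (r.im - c * m.im) ^ 2) / c := by positivity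
  linarith

/-- If `σ = R Rᴴ` and `ρ = R diag(x) Rᴴ`, then the variational expression for the resolvent
`⟪σ, (L_ρ + t R_σ)⁻¹ σ⟫` is bounded by its classical value. -/
lemma variational_le (R A : Matrix n n ℂ) {x : n → ℝ} (hx : ∀ k, 0 ≤ x k) {t : ℝ} (ht : 0 < t) :
    2 * (Aᴴ * (R * Rᴴ)).trace.re - (Aᴴ * (R * realDiag x * Rᴴ) * A).trace.re
        - t * (A * (R * Rᴴ) * Aᴴ).trace.re
      ≤ ∑ k, (∑ i, Complex.normSq (R i k)) * (1 / (x k + t)) := by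
  set M := Aᴴ * R with hM
  set N := A * R with hN
  have e2 : (Aᴴ * (R * realDiag x * Rᴴ) * A).trace.re
      = ∑ k, x k * ∑ i, Complex.normSq (M i k) := by
    have : Aᴴ * (R * realDiag x * Rᴴ) * A = M * realDiag x * Mᴴ := by
      simp [hM, Matrix.mul_assoc]
    rw [this, re_trace_mul_diag_mul_conjTranspose, Finset.sum_comm]
    simp only [Finset.mul_sum]
  have e3 : (A * (R * Rᴴ) * Aᴴ).trace.re = ∑ k, ∑ i, Complex.normSq (N i k) := by
    have : A * (R * Rᴴ) * Aᴴ = N * realDiag (fun _ => 1) * Nᴴ := by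
      simp [hN, Matrix.mul_assoc, realDiag_one]
    rw [this, re_trace_mul_diag_mul_conjTranspose, Finset.sum_comm]
    simp only [one_mul]
  have e1 : (Aᴴ * (R * Rᴴ)).trace.re = ∑ k, ((Rᴴ * M) k k).re := by
    rw [← Matrix.mul_assoc, trace_mul_comm, trace, Complex.re_sum]
    rfl
  have eMN : ∀ k, ((Rᴴ * M) k k).re = ((Rᴴ * N) k k).re := by
    intro k
    have : Rᴴ * M = (Rᴴ * N)ᴴ := by simp [hM, hN, Matrix.mul_assoc]
    rw [this, conjTranspose_apply]
    simp
  have hb : ∀ (Z : Matrix n n ℂ) (k : n) {c : ℝ}, 0 < c → 2 * ((Rᴴ * Z) k k).re ≤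
      (∑ i, Complex.normSq (R i k)) / c + c * ∑ i, Complex.normSq (Z i k) := by
    intro Z k c hc
    rw [mul_apply, Complex.re_sum, Finset.mul_sum, Finset.mul_sum, Finset.sum_div,
      ← Finset.sum_add_distrib]
    exact Finset.sum_le_sum fun i _ => two_mul_re_conj_mul_le hc _ _
  rw [e1, e2, e3, Finset.mul_sum, Finset.mul_sum, ← Finset.sum_sub_distrib,
    ← Finset.sum_sub_distrib]
  refine Finset.sum_le_sum fun k _ => ?_
  have hc : 0 < x k + t := add_pos_of_nonneg_of_pos (hx k) ht
  -- The linear term can be written with `M` or with `N`. Splitting it in proportions `x k : t`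
  -- makes the quadratic terms appear with exactly the weights `x k` and `t`, which cancel.
  have h1 := mul_le_mul_of_nonneg_left (hb M k hc) (div_nonneg (hx k) hc.le)
  have h2 := mul_le_mul_of_nonneg_left (hb N k hc) (div_nonneg ht.le hc.le)
  rw [← eMN] at h2
  have h3 := add_le_add h1 h2
  set s := ∑ i, Complex.normSq (R i k)
  set m := ∑ i, Complex.normSq (M i k)
  set l := ∑ i, Complex.normSq (N i k)
  set a := ((Rᴴ * M) k k).re
  have e5 : x k / (x k + t) * (2 * a) + t / (x k + t) * (2 * a) = 2 * a := by
    field_simp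
  have e6 : x k / (x k + t) * (s / (x k + t) + (x k + t) * m)
      + t / (x k + t) * (s / (x k + t) + (x k + t) * l)
      = s * (1 / (x k + t)) + x k * m + t * l := by
    field_simp
    ring
  linarith

/-- Comparison of the resolvent of the relative modular operator with the classical one. -/
lemma resolvent_le {U V R : Matrix n n ℂ} {lam μ x : n → ℝ} (hU : Uᴴ * U = 1) (hV : Vᴴ * V = 1)
    (hx : ∀ k, 0 ≤ x k)
    (hσ : V * realDiag μ * Vᴴ = R * Rᴴ)
    (hρ : U * realDiag lam * Uᴴ = R * realDiag x * Rᴴ) {t : ℝ} (ht : 0 < t) :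
    ∑ i, ∑ j, Complex.normSq ((Uᴴ * V) i j) * (μ j ^ 2 / (lam i + t * μ j))
      ≤ ∑ k, (∑ i, Complex.normSq (R i k)) * (1 / (x k + t)) := by
  set W := Uᴴ * V with hW
  -- In the eigenbases, the solution of the stationarity equation `ρ A + t A σ = σ`. Where the
  -- denominator vanishes, division by zero gives a zero entry, and the final identity still holds.
  let Y : Matrix n n ℂ := Matrix.of fun i j => W i j * ((μ j / (lam i + t * μ j) : ℝ) : ℂ)
  have key := variational_le R (U * Y * Vᴴ) hx ht
  rw [← hσ, ← hρ] at key
  have h1 : ((U * Y * Vᴴ)ᴴ * (V * realDiag μ * Vᴴ)).trace = (Yᴴ * (W * realDiag μ)).trace := by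
    have : (U * Y * Vᴴ)ᴴ * (V * realDiag μ * Vᴴ) = V * (Yᴴ * (W * realDiag μ)) * Vᴴ := by
      simp [hW, Matrix.mul_assoc]
    rw [this, trace_conj_unitary hV]
  have h2 : ((U * Y * Vᴴ)ᴴ * (U * realDiag lam * Uᴴ) * (U * Y * Vᴴ)).trace
      = (Yᴴ * realDiag lam * Y).trace := by
    have : (U * Y * Vᴴ)ᴴ * (U * realDiag lam * Uᴴ) * (U * Y * Vᴴ)
        = V * (Yᴴ * ((Uᴴ * U) * (realDiag lam * ((Uᴴ * U) * Y)))) * Vᴴ := by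
      simp [Matrix.mul_assoc]
    rw [this, trace_conj_unitary hV, hU]
    simp [Matrix.mul_assoc]
  have h3 : (U * Y * Vᴴ * (V * realDiag μ * Vᴴ) * (U * Y * Vᴴ)ᴴ).trace
      = (Y * realDiag μ * Yᴴ).trace := by
    have : U * Y * Vᴴ * (V * realDiag μ * Vᴴ) * (U * Y * Vᴴ)ᴴ
        = U * (Y * ((Vᴴ * V) * (realDiag μ * ((Vᴴ * V) * Yᴴ)))) * Uᴴ := by
      simp [Matrix.mul_assoc]
    rw [this, trace_conj_unitary hU, hV]
    simp [Matrix.mul_assoc]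
  have h4 : (Yᴴ * (W * realDiag μ)).trace.re
      = ∑ i, ∑ j, Complex.normSq (W i j) * (μ j ^ 2 / (lam i + t * μ j)) := by
    rw [re_trace_mul, Finset.sum_comm]
    simp only [mul_realDiag_apply, conjTranspose_apply]
    refine Finset.sum_congr rfl fun i _ => Finset.sum_congr rfl fun j _ => ?_
    simp only [Y, of_apply, star_mul', Complex.star_def, Complex.conj_ofReal]
    have : (starRingEnd ℂ) (W i j) * ((μ j / (lam i + t * μ j) : ℝ) : ℂ) * (W i j * (μ j : ℂ))
        = ((Complex.normSq (W i j) * (μ j ^ 2 / (lam i + t * μ j)) : ℝ) : ℂ) := by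
      push_cast
      rw [Complex.normSq_eq_conj_mul_self]
      ring
    rw [this, Complex.ofReal_re]
  rw [h1, h2, h3, h4, re_trace_conjTranspose_mul_diag_mul,
    re_trace_mul_diag_mul_conjTranspose] at key
  refine le_trans (le_of_eq ?_) key
  simp only [Finset.mul_sum, ← Finset.sum_sub_distrib]
  refine Finset.sum_congr rfl fun i _ => Finset.sum_congr rfl fun j _ => ?_
  simp only [Y, of_apply, Complex.normSq_mul, Complex.normSq_ofReal]
  obtain ⟨s, hs⟩ : ∃ s, s = lam i + t * μ j := ⟨_, rfl⟩
  rw [← hs, eq_sub_of_add_eq hs.symm]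
  by_cases h : s = 0
  · simp [h]
  · field_simp
    ring

/-! ### Kernels, congruence and supports. -/

lemma eq_zero_of_posSemidef_neg {n : Type*} [Fintype n] {A : Matrix n n ℂ} (h1 : A.PosSemidef) (h2 : (-A).PosSemidef) :
    A = 0 := by
  rw [← h1.trace_eq_zero_iff]
  have ha := h1.trace_nonneg
  have hb := h2.trace_nonneg
  rw [trace_neg] at hb
  exact le_antisymm (neg_nonneg.1 hb) ha

lemma eigenvalues_nonneg_of_posSemidef {V : Matrix n n ℂ} {μ : n → ℝ} (hV : Vᴴ * V = 1)
    (h : (V * realDiag μ * Vᴴ).PosSemidef) (i : n) : 0 ≤ μ i := by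
  revert i
  rw [← realDiag_posSemidef]
  have := h.conjTranspose_mul_mul_same V
  rwa [show Vᴴ * (V * realDiag μ * Vᴴ) * V = (Vᴴ * V) * realDiag μ * (Vᴴ * V) by
    simp only [Matrix.mul_assoc], hV, Matrix.one_mul, Matrix.mul_one] at this

/-- Writing `ρ = B Bᴴ`, the hypothesis reads `(P B)(P B)ᴴ = 0`, so `P B = 0`. -/
lemma mul_eq_zero_of_conj_eq_zero {ρ P : Matrix n n ℂ} (hρ : ρ.PosSemidef)
    (h : P * ρ * Pᴴ = 0) : P * ρ = 0 := by
  obtain ⟨V, μ, hV, hV', rfl, -⟩ := exists_diagonalization hρ.1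
  have hμ := eigenvalues_nonneg_of_posSemidef hV hρ
  have hs : realDiag μ = realDiag (fun i => √(μ i)) * (realDiag fun i => √(μ i))ᴴ := by
    rw [realDiag_conjTranspose, realDiag_mul]
    simp only [Real.mul_self_sqrt (hμ _)]
  have h0 : P * V * realDiag (fun i => √(μ i)) = 0 := by
    rw [← self_mul_conjTranspose_eq_zero, ← h, hs]
    simp only [conjTranspose_mul, Matrix.mul_assoc, realDiag_conjTranspose]
  calc P * (V * realDiag μ * Vᴴ)
      = (P * V * realDiag (fun i => √(μ i))) * (realDiag fun i => √(μ i))ᴴ * Vᴴ := by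
        rw [hs]; simp only [Matrix.mul_assoc]
    _ = 0 := by rw [h0, Matrix.zero_mul, Matrix.zero_mul]

/-- The kernel projector of `σ` annihilates every `ρ ≤ c σ`. -/
lemma kernel_projector_mul_eq_zero {ρ V : Matrix n n ℂ} {μ : n → ℝ} {c : ℝ} (hV : Vᴴ * V = 1)
    (hρ : ρ.PosSemidef) (hle : ((c : ℂ) • (V * realDiag μ * Vᴴ) - ρ).PosSemidef) :
    V * realDiag (fun i => if μ i = 0 then 1 else 0) * Vᴴ * ρ = 0 := by
  set P := V * realDiag (fun i => if μ i = 0 then (1 : ℝ) else 0) * Vᴴ with hP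
  refine mul_eq_zero_of_conj_eq_zero hρ
    (eq_zero_of_posSemidef_neg (hρ.mul_mul_conjTranspose_same P) ?_)
  have hPσ : P * (V * realDiag μ * Vᴴ) = 0 := by
    have h0 : (fun i => (if μ i = 0 then (1 : ℝ) else 0) * μ i) = fun _ => 0 := by
      ext i
      split_ifs with h <;> simp [h]
    rw [hP, conj_unitary_mul hV, realDiag_mul, h0]
    simp [realDiag]
  have := hle.mul_mul_conjTranspose_same P
  rwa [Matrix.mul_sub, Matrix.mul_smul, hPσ, smul_zero, zero_sub, Matrix.neg_mul] at this

/-- Simultaneous diagonalization by congruence of two mutually dominated positive semidefinite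
matrices, with the relative eigenvalues between `c⁻¹` and `c`. -/
lemma exists_congruence {ρ V : Matrix n n ℂ} {μ : n → ℝ} {c : ℝ} (hV : Vᴴ * V = 1)
    (hV' : V * Vᴴ = 1) (hc : 1 ≤ c) (hρ : ρ.PosSemidef) (hμ : ∀ i, 0 ≤ μ i)
    (h1 : ((c : ℂ) • (V * realDiag μ * Vᴴ) - ρ).PosSemidef)
    (h2 : ((c : ℂ) • ρ - V * realDiag μ * Vᴴ).PosSemidef) :
    ∃ (R : Matrix n n ℂ) (x : n → ℝ), V * realDiag μ * Vᴴ = R * Rᴴ ∧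
      ρ = R * realDiag x * Rᴴ ∧ (∀ k, c⁻¹ ≤ x k) ∧ ∀ k, x k ≤ c := by
  have hc0 : 0 < c := by linarith
  have hk := kernel_projector_mul_eq_zero hV hρ h1
  set z : n → ℝ := fun i => if μ i = 0 then 1 else 0 with hz
  set S := V * realDiag (fun i => √(μ i)) with hS
  set T := realDiag (fun i => (√(μ i))⁻¹) * Vᴴ with hT
  -- `T` is a pseudo-inverse of `S`, so `T ρ Tᴴ` is `ρ` relative to `σ`. The summand `realDiag z`
  -- places the value one, which lies in `[c⁻¹, c]`, on the kernel of `σ`; `S` annihilates it.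
  set X := T * ρ * Tᴴ + realDiag z with hX
  have hz0 : ∀ i, 0 ≤ z i := fun i => by simp only [hz]; split_ifs <;> simp
  have hTσ : T * (V * realDiag μ * Vᴴ) * Tᴴ = 1 - realDiag z := by
    have : T * (V * realDiag μ * Vᴴ) * Tᴴ = realDiag (fun i => (√(μ i))⁻¹) *
        ((Vᴴ * V) * realDiag μ * (Vᴴ * V)) * realDiag (fun i => (√(μ i))⁻¹) := by
      simp only [hT, conjTranspose_mul, conjTranspose_conjTranspose, realDiag_conjTranspose,
        Matrix.mul_assoc]
    rw [this, hV, Matrix.one_mul, Matrix.mul_one, realDiag_mul, realDiag_mul, ← realDiag_one,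
      realDiag_sub]
    congr 1
    ext i
    simp only [hz]
    split_ifs with h
    · simp [h]
    · have := Real.sqrt_ne_zero'.2 (lt_of_le_of_ne (hμ i) (Ne.symm h))
      rw [sub_zero]
      nth_rw 2 [← Real.mul_self_sqrt (hμ i)]
      field_simp
  have hST : S * T = 1 - V * realDiag z * Vᴴ := by
    have : S * T = V * (realDiag (fun i => √(μ i)) * realDiag (fun i => (√(μ i))⁻¹)) * Vᴴ := by
      simp only [hS, hT, Matrix.mul_assoc]
    have h' : (1 : Matrix n n ℂ) - V * realDiag z * Vᴴ = V * realDiag (fun i => 1 - z i) * Vᴴ := by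
      rw [← realDiag_sub, realDiag_one, Matrix.mul_sub, Matrix.sub_mul, Matrix.mul_one, hV']
    rw [this, h', realDiag_mul]
    congr 3
    ext i
    simp only [hz]
    split_ifs with h
    · simp [h]
    · rw [mul_inv_cancel₀ (Real.sqrt_ne_zero'.2 (lt_of_le_of_ne (hμ i) (Ne.symm h))), sub_zero]
  have hSz : S * realDiag z = 0 := by
    rw [hS, Matrix.mul_assoc, realDiag_mul]
    have : (fun i => √(μ i) * z i) = fun _ => 0 := by
      ext i
      simp only [hz]
      split_ifs with h <;> simp [h]
    rw [this]
    simp [realDiag]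
  have hSS : S * Sᴴ = V * realDiag μ * Vᴴ := by
    rw [hS, conjTranspose_mul, realDiag_conjTranspose, Matrix.mul_assoc,
      ← Matrix.mul_assoc (realDiag _) (realDiag _), realDiag_mul, Matrix.mul_assoc]
    simp only [Real.mul_self_sqrt (hμ _)]
  have hSTρ : S * T * ρ = ρ := by
    rw [hST, Matrix.sub_mul, Matrix.one_mul, hk, sub_zero]
  have hSX : S * X * Sᴴ = ρ := by
    have e1 : S * X * Sᴴ = S * T * ρ * (S * T)ᴴ + S * realDiag z * Sᴴ := by
      simp only [hX, Matrix.mul_add, Matrix.add_mul, conjTranspose_mul, Matrix.mul_assoc]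
    have e2 : ρ * (S * T)ᴴ = ρ := by
      have := congrArg conjTranspose hSTρ
      rwa [conjTranspose_mul, hρ.1] at this
    rw [e1, hSz, Matrix.zero_mul, add_zero, hSTρ, e2]
  have hXH : X.IsHermitian :=
    (hρ.mul_mul_conjTranspose_same T).1.add (realDiag_conjTranspose z)
  obtain ⟨Z, x, hZ, hZ', hXZ, -⟩ := exists_diagonalization hXH
  have hshift : ∀ a b : ℝ, Z * realDiag (fun k => a * x k + b) * Zᴴ
      = (a : ℂ) • X + (b : ℂ) • 1 := by
    intro a b
    rw [← realDiag_add, ← smul_realDiag, Matrix.mul_add, Matrix.add_mul, Matrix.mul_smul,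
      Matrix.smul_mul, ← hXZ]
    have : (realDiag fun _ : n => b) = (b : ℂ) • 1 := by
      rw [← realDiag_one, smul_realDiag]; simp
    rw [this, Matrix.mul_smul, Matrix.smul_mul, Matrix.mul_one, hZ']
  have hzc : ((((c - 1 : ℝ)) : ℂ) • realDiag z).PosSemidef := by
    rw [smul_realDiag, realDiag_posSemidef]
    exact fun i => mul_nonneg (by linarith) (hz0 i)
  refine ⟨S * Z, x, ?_, ?_, fun k => ?_, fun k => ?_⟩
  · rw [conjTranspose_mul, Matrix.mul_assoc S, ← Matrix.mul_assoc Z, hZ', Matrix.one_mul, hSS]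
  · rw [conjTranspose_mul]
    conv_lhs => rw [← hSX, hXZ]
    simp only [Matrix.mul_assoc]
  -- `c X - 1 = T (c ρ - σ) Tᴴ + (c - 1) z`, and `c ≥ 1`; the upper bound is symmetric.
  · have hp : (Z * realDiag (fun k => c * x k + (-1)) * Zᴴ).PosSemidef := by
      rw [hshift]
      have := (h2.mul_mul_conjTranspose_same T).add hzc
      rw [Matrix.mul_sub, Matrix.sub_mul, hTσ, Matrix.mul_smul, Matrix.smul_mul] at this
      convert this using 1
      rw [hX]
      push_cast
      module
    have := eigenvalues_nonneg_of_posSemidef hZ hp k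
    rw [inv_le_iff_one_le_mul₀ hc0]
    linarith
  · have hp : (Z * realDiag (fun k => (-1) * x k + c) * Zᴴ).PosSemidef := by
      rw [hshift]
      have := (h1.mul_mul_conjTranspose_same T).add hzc
      rw [Matrix.mul_sub, Matrix.sub_mul, Matrix.mul_smul, Matrix.smul_mul, hTσ] at this
      convert this using 1
      rw [hX]
      push_cast
      module
    have := eigenvalues_nonneg_of_posSemidef hZ hp k
    linarith

/-- Domination of positive semidefinite matrices implies inclusion of the supports. -/
lemma supp_le_of_dominated {ρ σ : Matrix n n ℂ} {c : ℝ} (hρ : ρ.PosSemidef) (hσ : σ.PosSemidef)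
    (hle : ((c : ℂ) • σ - ρ).PosSemidef) : supp ρ ≤ supp σ := by
  obtain ⟨V, μ, hV, hV', rfl, -⟩ := exists_diagonalization hσ.1
  have hμ := eigenvalues_nonneg_of_posSemidef hV hσ
  have hk := kernel_projector_mul_eq_zero hV hρ hle
  refine Submodule.span_le.2 ?_
  rintro v ⟨m, hm, hv⟩
  have hm' : (m : ℂ) ≠ 0 := by exact_mod_cast hm.ne'
  set z : n → ℝ := fun i => if μ i = 0 then 1 else 0 with hz
  have hPv : (V * realDiag z * Vᴴ) *ᵥ v = 0 := by
    have : (V * realDiag z * Vᴴ) *ᵥ (ρ *ᵥ v) = 0 := by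
      rw [mulVec_mulVec, hk, zero_mulVec]
    rw [hv, mulVec_smul] at this
    exact (smul_eq_zero.1 this).resolve_left hm'
  have hw : realDiag z *ᵥ (Vᴴ *ᵥ v) = 0 := by
    have := congrArg (fun u => Vᴴ *ᵥ u) hPv
    simp only [mulVec_mulVec, mulVec_zero, ← Matrix.mul_assoc, hV, Matrix.one_mul] at this ⊢
    exact this
  set w := Vᴴ *ᵥ v with hwdef
  -- Expansion in the eigenbasis of `σ`; the coefficients at zero eigenvalues vanish by `hw`.
  have hvw : v = ∑ j, w j • V.col j := by
    have : v = V *ᵥ w := by rw [hwdef, mulVec_mulVec, hV', one_mulVec]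
    rw [this]
    ext i
    simp [mulVec, dotProduct, mul_comm]
  rw [hvw]
  refine Submodule.sum_mem _ fun j _ => ?_
  by_cases hj : μ j = 0
  · have : w j = 0 := by
      have := congrFun hw j
      simpa [realDiag, mulVec_diagonal, hz, hj] using this
    rw [this, zero_smul]
    exact Submodule.zero_mem _
  · refine Submodule.smul_mem _ _ (Submodule.subset_span
      ⟨μ j, lt_of_le_of_ne (hμ j) (Ne.symm hj), ?_⟩)
    have hc : V.col j = V *ᵥ Pi.single j 1 := by simp
    rw [hc, mulVec_mulVec, Matrix.mul_assoc, hV, Matrix.mul_one, ← mulVec_mulVec, ← mulVec_smul]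
    congr 1
    ext i
    by_cases h : i = j <;> simp [realDiag, mulVec_diagonal, h]

/-! ### The relative entropy bound. -/

/-- Trace of a product of two diagonalized matrices. -/
lemma re_trace_conj_mul_conj (U V : Matrix n n ℂ) (d e : n → ℝ) :
    ((U * realDiag d * Uᴴ) * (V * realDiag e * Vᴴ)).trace.re
      = ∑ i, ∑ j, Complex.normSq ((Uᴴ * V) i j) * (d i * e j) := by
  have : ((U * realDiag d * Uᴴ) * (V * realDiag e * Vᴴ)).trace
      = (realDiag d * ((Uᴴ * V) * realDiag e * (Uᴴ * V)ᴴ)).trace := by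
    rw [Matrix.mul_assoc, Matrix.mul_assoc, trace_mul_comm]
    congr 1
    simp only [conjTranspose_mul, conjTranspose_conjTranspose, Matrix.mul_assoc]
  rw [this, ← Matrix.mul_assoc, re_trace_mul]
  generalize Uᴴ * V = W
  simp only [realDiag_mul_apply, mul_realDiag_apply, conjTranspose_apply]
  refine Finset.sum_congr rfl fun i _ => Finset.sum_congr rfl fun j _ => ?_
  simp [Complex.normSq_apply]
  ring

lemma sum_normSq_of_unitary {W : Matrix n n ℂ} (hW : W * Wᴴ = 1) (i : n) :
    ∑ j, Complex.normSq (W i j) = 1 := by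
  have := congrArg Complex.re (congrFun (congrFun hW i) i)
  simp only [mul_apply, conjTranspose_apply, Complex.re_sum, one_apply_eq, Complex.one_re] at this
  rw [← this]
  exact Finset.sum_congr rfl fun j _ => by simp [Complex.normSq_apply]

/-- The bound on the relative entropy of a differentially private pair. -/
theorem relEntropy_le {ε : ℝ} (hε : 0 ≤ ε) {ρ σ : Matrix n n ℂ}
    (h : (ρ, σ) ∈ dpPairs n ε 0) :
    relEntropy ρ σ ≤ ((ε * Real.tanh (ε / 2) : ℝ) : EReal) := by
  obtain ⟨hd1, hd2⟩ := dp_posSemidef h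
  obtain ⟨⟨hρ, hρ1⟩, ⟨hσ, hσ1⟩, -⟩ := h
  dsimp only at hρ hρ1 hσ hσ1
  rw [relEntropy, if_pos (supp_le_of_dominated hρ hσ hd1), EReal.coe_le_coe_iff]
  obtain ⟨U, lam, hU, hU', hρU, hfρ⟩ := exists_diagonalization hρ.1
  obtain ⟨V, μ, hV, hV', hσV, hfσ⟩ := exists_diagonalization hσ.1
  have hlam := eigenvalues_nonneg_of_posSemidef hU (hρU ▸ hρ)
  have hμ := eigenvalues_nonneg_of_posSemidef hV (hσV ▸ hσ)
  rw [hσV] at hd1 hd2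
  obtain ⟨R, x, hσR, hρR, hxl, hxu⟩ :=
    exists_congruence hV hV' (Real.one_le_exp hε) hρ hμ hd1 hd2
  have hx : ∀ k, 0 ≤ x k := fun k => (inv_nonneg.2 (Real.exp_pos ε).le).trans (hxl k)
  set W := Uᴴ * V with hW
  have hWW : W * Wᴴ = 1 := by
    rw [hW, conjTranspose_mul, conjTranspose_conjTranspose, Matrix.mul_assoc,
      ← Matrix.mul_assoc V, hV', Matrix.one_mul, hU]
  have hWW' : Wᴴ * W = 1 := by
    rw [hW, conjTranspose_mul, conjTranspose_conjTranspose, Matrix.mul_assoc,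
      ← Matrix.mul_assoc U, hU', Matrix.one_mul, hV]
  have hrow := sum_normSq_of_unitary hWW
  have hcol : ∀ j, ∑ i, Complex.normSq (W i j) = 1 := fun j => by
    have := sum_normSq_of_unitary (W := Wᴴ) (by rwa [conjTranspose_conjTranspose]) j
    simpa [conjTranspose_apply, Complex.normSq_conj] using this
  have hlam1 : ∑ i, lam i = 1 := by
    have := congrArg Complex.re hρ1
    rwa [hρU, trace_conj_unitary hU, trace_realDiag, Complex.ofReal_re] at this
  have hμ1 : ∑ j, μ j = 1 := by
    have := congrArg Complex.re hσ1
    rwa [hσV, trace_conj_unitary hV, trace_realDiag, Complex.ofReal_re] at this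
  -- The trace of `ρ` against the kernel projector of `σ` is zero and is a sum of nonnegative terms.
  have hker : ∀ i j, μ j = 0 → Complex.normSq (W i j) * lam i = 0 := by
    intro i j hj
    have h0 := congrArg (fun M => M.trace.re) (kernel_projector_mul_eq_zero hV hρ hd1)
    simp only [trace_mul_comm _ ρ, trace_zero, Complex.zero_re] at h0
    rw [hρU, re_trace_conj_mul_conj] at h0
    have hnn : ∀ i j, 0 ≤ Complex.normSq (W i j) * (lam i * if μ j = 0 then 1 else 0) :=
      fun i j => mul_nonneg (Complex.normSq_nonneg _)
        (mul_nonneg (hlam i) (by split_ifs <;> simp))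
    have h1 := (Finset.sum_eq_zero_iff_of_nonneg fun i _ =>
      Finset.sum_nonneg fun j _ => hnn i j).1 h0 i (Finset.mem_univ i)
    have h2 := (Finset.sum_eq_zero_iff_of_nonneg fun j _ => hnn i j).1 h1 j (Finset.mem_univ j)
    simpa [hj] using h2
  -- The Nussbaum–Szkoła distribution and its likelihood ratio. Where `μ` vanishes the ratio takes
  -- the default value zero, but its weight `p` is zero too.
  set p : n × n → ℝ := fun a => Complex.normSq (W a.1 a.2) * μ a.2 with hp
  set y : n × n → ℝ := fun a => lam a.1 / μ a.2 with hy
  set q : n → ℝ := fun k => ∑ i, Complex.normSq (R i k) with hq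
  have hpy : ∀ a, p a * y a = Complex.normSq (W a.1 a.2) * lam a.1 := by
    intro a
    by_cases hj : μ a.2 = 0
    · simp [hp, hj, hker a.1 a.2 hj]
    · simp only [hp, hy]
      field_simp
  have hp1 : ∑ a, p a = 1 := by
    rw [Fintype.sum_prod_type_right]
    simp only [hp, ← Finset.sum_mul, hcol, one_mul, hμ1]
  have hpy1 : ∑ a, p a * y a = 1 := by
    simp only [hpy]
    rw [Fintype.sum_prod_type]
    simp only [← Finset.sum_mul, hrow, one_mul, hlam1]
  have hq1 : ∑ k, q k = 1 := by
    have := re_trace_mul_diag_mul_conjTranspose (fun _ => 1) R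
    rw [realDiag_one, Matrix.mul_one, ← hσR, ← hσV, hσ1] at this
    simp only [one_mul, Complex.one_re] at this
    rw [this, Finset.sum_comm]
  have hqx1 : ∑ k, q k * x k = 1 := by
    have := re_trace_mul_diag_mul_conjTranspose x R
    rw [← hρR, hρ1, Complex.one_re, Finset.sum_comm] at this
    rw [this]
    simp only [hq, mul_comm _ (x _), Finset.mul_sum]
  have hres : ∀ t, 0 < t → ∑ a, p a * (1 / (y a + t)) ≤ ∑ k, q k * (1 / (x k + t)) := by
    intro t ht
    refine le_trans (le_of_eq ?_) (resolvent_le hU hV hx hσR (hρU ▸ hρR) ht)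
    rw [Fintype.sum_prod_type]
    refine Finset.sum_congr rfl fun i _ => Finset.sum_congr rfl fun j _ => ?_
    simp only [hp, hy, mul_assoc]
    congr 1
    by_cases hj : μ j = 0
    · simp [hj]
    · field_simp
  have hmain := (sum_mul_log_le_of_resolvent p y q x
    (fun a => div_nonneg (hlam _) (hμ _)) hx (hp1.trans hq1.symm) (hpy1.trans hqx1.symm) hres).trans
    (sum_mul_log_le_tanh hε q x (fun k => Finset.sum_nonneg fun i _ => Complex.normSq_nonneg _)
      hq1 hqx1 hxl hxu)
  rw [tanh_half_eq]
  refine le_trans (le_of_eq ?_) hmain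
  have hρlog : (ρ * cfc Real.log ρ).trace.re
      = ∑ i, ∑ j, Complex.normSq (W i j) * (lam i * Real.log (lam i)) := by
    rw [hfρ]
    conv_lhs => rw [hρU]
    rw [conj_unitary_mul hU, trace_conj_unitary hU, realDiag_mul, trace_realDiag,
      Complex.ofReal_re]
    simp only [← Finset.sum_mul, hrow, one_mul]
  have hσlog : (ρ * cfc Real.log σ).trace.re
      = ∑ i, ∑ j, Complex.normSq (W i j) * (lam i * Real.log (μ j)) := by
    rw [hfσ, hρU, re_trace_conj_mul_conj]
  rw [log, log, Matrix.mul_sub, trace_sub, Complex.sub_re, hρlog, hσlog, Fintype.sum_prod_type,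
    ← Finset.sum_sub_distrib]
  refine Finset.sum_congr rfl fun i _ => ?_
  rw [← Finset.sum_sub_distrib]
  refine Finset.sum_congr rfl fun j _ => ?_
  rw [← mul_assoc (p (i, j)), hpy, ← mul_sub, ← mul_sub, ← mul_assoc]
  by_cases hl : Complex.normSq (W i j) * lam i = 0
  · simp [hl]
  · have hj : μ j ≠ 0 := fun h0 => hl (hker i j h0)
    have hi : lam i ≠ 0 := fun h0 => hl (by rw [h0, mul_zero])
    simp only [hy, Real.log_div hi hj]

end QuantumDP

theorem mainTheorem11 {n : Type*} [Fintype n] [DecidableEq n] (ε : ℝ) (hε : 0 ≤ ε)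
    (ρ σ : Matrix n n ℂ) (h : (ρ, σ) ∈ QuantumDP.dpPairs n ε 0) :
    QuantumDP.relEntropy ρ σ ≤ ((ε * Real.tanh (ε / 2) : ℝ) : EReal) ∧
      QuantumDP.traceNorm (ρ - σ) ≤ 2 * Real.tanh (ε / 2) :=
  ⟨QuantumDP.relEntropy_le hε h, QuantumDP.traceNorm_sub_le h⟩
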